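/- **Setting.** Let $H$ be a real Hilbert space, $T>0$, and write $d_S(x)=\inf_{z\in S}\|x-z\|$. For $\varepsilon>0$ put $\operatorname{proj}^{\varepsilon}_S(x)=\{z\in S:\ \|x-z\|^2<d_S(x)^2+\varepsilon\}$. The Clarke tangent cone $T(S;x)$ at $x\in S$ is the set of $v\in H$ such that for all sequences $S\ni y_n\to x$ and $\tau_n\to 0$ with $\tau_n>0$ there are $v_n\to v$ with $y_n+\tau_n v_n\in S$ for all $n$; the Clarke normal cone is $N(S;x)=\{\xi\in H:\ \langle \xi,v\rangle\le 0\ \ \forall v\in T(S;x)\}$ if $x\in S$, and $N(S;x)=\emptyset$ if $x\notin S$. Assume: 1. $C(t)\subset H$, $t\in[0,T]$, are nonempty closed sets, and there is $L_C\ge 0$ such that the Hausdorff distance satisfies $d_H(C(t),C(s))\le L_C|t-s|$ for all $t,s\in[0,T]$. 2. $F\colon[0,T]\times H\rightrightarrows H$ has nonempty, closed, convex values, and for every $t\in[0,T]$ the map $F(t,\cdot)$ is upper semicontinuous from $H$ into $H$ with the weak topology, that is, $\{x: F(t,x)\cap W\ne\emptyset\}$ is closed for every weakly closed $W\subset H$.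 3. There is a Lipschitz function $h\colon H\to[0,\infty)$ such that $d_{F(t,x)}(0)\le h(x)$ for all $x\in H$ and a.e. $t\in[0,T]$. 4. $\gamma>0$ and $f\colon[0,T]\times H\to H$ satisfy $f(t,x)\in\operatorname{proj}^{\gamma}_{F(t,x)}(0)$ for all $(t,x)$, and $f(\cdot,x)$ is (strongly, Lebesgue) measurable on $[0,T]$ for every $x\in H$. Let $x_0\in C(0)$. For $n\ge 1$ let $\mu_n=T/n$ and $t_k^n=k\mu_n$ $(0\le k\le n)$, and let $\varepsilon_n>0$ be such that $\varepsilon_n/\mu_n^2\to0$. For each $n\ge1$ let $x_0^n=x_0$, let $$x_{k+1}^n\in\operatorname{proj}^{\varepsilon_n}_{C(t_{k+1}^n)}\Big(x_k^n+\int_{t_k^n}^{t_{k+1}^n}f(s,x_k^n)\,ds\Big),\qquad 0\le k\le n-1,$$ be any choice of approximate projections, and let $x_n\colon[0,T]\to H$ be given by $x_n(0)=x_0$ and, for $t\in\,]t_k^n,t_{k+1}^n]$, $$x_n(t)=x_k^n+\frac{t-t_k^n}{\mu_n}\Big(x_{k+1}^n-x_k^n-\int_{t_k^n}^{t_{k+1}^n}f(s,x_k^n)\,ds\Big)+\int_{t_k^n}^{t}f(s,x_k^n)\,ds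 .$$ **Theorem 5.1 (subsmooth case).** Assume in addition that * the family $(C(t))_{t\in[0,T]}$ is equi-uniformly subsmooth: for every $\varepsilon>0$ there is $\delta>0$ such that for all $t\in[0,T]$, all $x_1,x_2\in C(t)$ with $\|x_1-x_2\|\le\delta$ and all $\xi_i\in N(C(t);x_i)$ with $\|\xi_i\|\le1$ $(i=1,2)$ one has $\langle\xi_2-\xi_1,x_2-x_1\rangle\ge-\varepsilon\|x_2-x_1\|$; * each $C(t)$ is ball-compact: $C(t)\cap\{z:\|z\|\le r\}$ is compact for every $r>0$. Then there are a subsequence of $(x_n)_{n\ge1}$ and an absolutely continuous function $x\colon[0,T]\to H$ such that the subsequence converges to $x$ uniformly on $[0,T]$, and $x$ is a solution of the perturbed sweeping process $$\dot x(t)\in -N(C(t);x(t))+F(t,x(t))\quad\text{for a.e. }t\in[0,T],\qquad x(0)=x_0 .$$ -/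

import Mathlib

open Set Filter Topology MeasureTheory
open scoped NNReal ENNReal Pointwise

namespace Sweeping

variable {H : Type*} [NormedAddCommGroup H] [InnerProductSpace ℝ H]

/-- The Clarke tangent cone to `S` at `x`, in its sequential description. -/
def clarkeTangentCone (S : Set H) (x : H) : Set H :=
  {v | ∀ (y : ℕ → H) (τ : ℕ → ℝ), (∀ n, y n ∈ S) → Tendsto y atTop (𝓝 x) →
    (∀ n, 0 < τ n) → Tendsto τ atTop (𝓝 0) →
    ∃ w : ℕ → H, Tendsto w atTop (𝓝 v) ∧ ∀ n, y n + τ n • w n ∈ S}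

/-- The Clarke normal cone to `S` at `x`: the negative polar of the Clarke tangent cone if
`x ∈ S`, and the empty set if `x ∉ S`. -/
def clarkeNormalCone (S : Set H) (x : H) : Set H :=
  {ξ | x ∈ S ∧ ∀ v ∈ clarkeTangentCone S x, inner ℝ ξ v ≤ 0}

/-- The family `(S t)_{t ∈ I}` is equi-uniformly subsmooth. -/
def EquiUniformlySubsmooth {ι : Type*} (I : Set ι) (S : ι → Set H) : Prop :=
  ∀ ε : ℝ, 0 < ε → ∃ δ : ℝ, 0 < δ ∧ ∀ t ∈ I, ∀ x₁ ∈ S t, ∀ x₂ ∈ S t, ‖x₁ - x₂‖ ≤ δ →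
    ∀ ξ₁ ∈ clarkeNormalCone (S t) x₁, ∀ ξ₂ ∈ clarkeNormalCone (S t) x₂,
      ‖ξ₁‖ ≤ 1 → ‖ξ₂‖ ≤ 1 → -ε * ‖x₂ - x₁‖ ≤ inner ℝ (ξ₂ - ξ₁) (x₂ - x₁)

/-- `S` is ball-compact: its intersection with every closed ball around the origin is compact
(in the norm topology). -/
def BallCompact (S : Set H) : Prop :=
  ∀ r : ℝ, 0 < r → IsCompact (S ∩ Metric.closedBall 0 r)

/-- The set-valued map `G` is upper semicontinuous from `H` (norm topology) into `H` with its
weak topology: inverse images of weakly closed sets are closed. -/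
def UpperSemicontinuousToWeak (G : H → Set H) : Prop :=
  ∀ W : Set H, IsClosed (toWeakSpace ℝ H '' W) → IsClosed {x | (G x ∩ W).Nonempty}

/-- The set of `ε`-approximate projections of `x` onto `S`. -/
def approxProj (ε : ℝ) (S : Set H) (x : H) : Set H :=
  {z | z ∈ S ∧ ‖x - z‖ ^ 2 < Metric.infDist x S ^ 2 + ε}

/-- The `k`-th node of the uniform partition of `[0, T]` into `n` intervals. -/
noncomputable def gridTime (T : ℝ) (n k : ℕ) : ℝ := k * (T / n)

/-- `y` is (on `[0, T]`) an `n`-th iterate of the catching-up algorithm with approximate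
projections, with moving set `C`, perturbation `f`, initial point `x₀`, and tolerance `ε`;
the points `p k` are its values at the nodes of the partition. -/
def IsCatchingUpIterate (T : ℝ) (C : ℝ → Set H) (f : ℝ → H → H) (x₀ : H) (ε : ℝ) (n : ℕ)
    (y : ℝ → H) : Prop :=
  ∃ p : ℕ → H, p 0 = x₀ ∧
    (∀ k < n, p (k + 1) ∈ approxProj ε (C (gridTime T n (k + 1)))
      (p k + ∫ s in gridTime T n k..gridTime T n (k + 1), f s (p k))) ∧
    y 0 = x₀ ∧
    ∀ k < n, ∀ t ∈ Ioc (gridTime T n k) (gridTime T n (k + 1)),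
      y t = p k
        + ((t - gridTime T n k) / (T / n)) •
            (p (k + 1) - p k - ∫ s in gridTime T n k..gridTime T n (k + 1), f s (p k))
        + ∫ s in gridTime T n k..t, f s (p k)

/-- `x` is an absolutely continuous solution on `[0, T]` of the perturbed sweeping process
`x'(t) ∈ -N(C(t); x(t)) + F(t, x(t))` a.e., `x(0) = x₀`. -/
def IsSweepingSolution (T : ℝ) (C : ℝ → Set H) (F : ℝ → H → Set H) (x₀ : H)
    (x : ℝ → H) : Prop :=
  AbsolutelyContinuousOnInterval x 0 T ∧ x 0 = x₀ ∧
    ∀ᵐ t ∂(volume.restrict (Icc 0 T)), DifferentiableAt ℝ x t ∧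
      deriv x t ∈ -clarkeNormalCone (C t) (x t) + F t (x t)

end Sweeping

/-!
The interpolations of the catching-up algorithm are approximate solutions, and approximate
solutions are closed under uniform limits.

By a discrete Grönwall inequality the nodes stay bounded and all velocities are bounded by one
constant `M`, uniformly in the mesh (`norm_node_sub_le`). The velocity of the `n`-th curve is
`V + G` with `G t = f(t, p) ∈ F(t, p)` for a node `p` near the curve. An approximate projection is
almost stationary: minimising `‖y - u‖² + ‖u - z‖²` over the ball-compact set gives a point `z'`
within `√ε` of the approximate projection `z` of `y` at which `y - z` differs from a normal vector
by at most `2√ε` (`exists_mem_clarkeNormalCone_of_mem_approxProj`). After division by the mesh the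
error still vanishes, because `ε / μ² → 0`; so `-V t` is almost normal to the moving set at a nearby
time and point. These properties are collected in `IsApproxSolution`.

The curves are equi-Lipschitz and approach the compact sets `C(t) ∩ B(0, r)`, so the Arzelà–Ascoli
theorem gives a uniformly convergent subsequence. For the velocities, weak compactness in `L²` and
Mazur's lemma are replaced by one elementary fact: nested bounded closed convex sets in a Hilbert
space intersect. Applied in `L²([0, T]; H × H)` to the closed convex hulls of the tails of `(V, G)`,
it gives `(v, w)` that lies a.e. in the closed convex hulls of the pointwise tails, with
`x(t) = x₀ + ∫₀ᵗ (v + w)`; hence `x' = v + w` a.e. by Lebesgue's differentiation theorem.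
Upper semicontinuity and separation yield `w(t) ∈ F(t, x(t))` (`mem_of_forall_inner_le`), and
equi-uniform subsmoothness yields `-v(t) ∈ N(C(t); x(t))` (`mem_clarkeNormalCone_of_tendsto`).
-/

/-! ### Generalized limits of bounded sequences of functions -/

/-- Nested nonempty closed convex sets in a Hilbert space, the first of them bounded, have a common
point: the limit of their elements of minimal norm. This replaces weak compactness of balls. -/
theorem exists_forall_mem_of_antitone_of_convex {E : Type*} [NormedAddCommGroup E]
    [InnerProductSpace ℝ E] [CompleteSpace E] {K : ℕ → Set E} (hanti : Antitone K)
    (hne : ∀ n, (K n).Nonempty) (hcl : ∀ n, IsClosed (K n)) (hconv : ∀ n, Convex ℝ (K n))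
    {M : ℝ} (hM : ∀ x ∈ K 0, ‖x‖ ≤ M) : ∃ g, ∀ n, g ∈ K n := by
  have hmin : ∀ n, ∃ v ∈ K n, ∀ w ∈ K n, ‖v‖ ≤ ‖w‖ := by
    intro n
    obtain ⟨v, hv, hvm⟩ :=
      exists_norm_eq_iInf_of_complete_convex (hne n) (hcl n).isComplete (hconv n) 0
    refine ⟨v, hv, fun w hw => ?_⟩
    have : ⨅ w : K n, ‖(0 : E) - w‖ ≤ ‖(0 : E) - (⟨w, hw⟩ : K n)‖ :=
      ciInf_le ⟨0, Set.forall_mem_range.2 fun _ => norm_nonneg _⟩ _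
    rw [← hvm] at this
    simpa using this
  choose m hm hmle using hmin
  have hmono : Monotone fun n => ‖m n‖ := fun i j hij => hmle i _ (hanti hij (hm j))
  have hbdd : BddAbove (range fun n => ‖m n‖) :=
    ⟨M, by rintro _ ⟨n, rfl⟩; exact hM _ (hanti (Nat.zero_le n) (hm n))⟩
  have hlim := tendsto_atTop_ciSup hmono hbdd
  have hsq := (hlim.pow 2).cauchySeq
  -- The parallelogram identity at two minimisers, whose midpoint is again a competitor.
  have hpar : ∀ i j, i ≤ j → ‖m i - m j‖ ^ 2 ≤ 2 * (‖m j‖ ^ 2 - ‖m i‖ ^ 2) := by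
    intro i j hij
    have hmid := hmle i _ ((hconv i) (hm i) (hanti hij (hm j)) (by norm_num : (0 : ℝ) ≤ 1 / 2)
      (by norm_num : (0 : ℝ) ≤ 1 / 2) (by norm_num))
    rw [← smul_add, norm_smul] at hmid
    norm_num at hmid
    have := parallelogram_law_with_norm ℝ (m i) (m j)
    nlinarith [norm_nonneg (m i), norm_nonneg (m i + m j)]
  have hcau : CauchySeq m := by
    rw [Metric.cauchySeq_iff']
    intro ε hε
    obtain ⟨N, hN⟩ := Metric.cauchySeq_iff'.1 hsq (ε ^ 2 / 2) (by positivity)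
    refine ⟨N, fun n hn => ?_⟩
    have h1 := hN n hn
    have h2 := hpar N n hn
    rw [Real.dist_eq] at h1
    have h3 := (abs_lt.1 h1).2
    rw [dist_comm, dist_eq_norm]
    exact lt_of_pow_lt_pow_left₀ 2 hε.le (by linarith)
  obtain ⟨g, hg⟩ := cauchySeq_tendsto_of_complete hcau
  exact ⟨g, fun n => (hcl n).mem_of_tendsto hg
    ((eventually_ge_atTop n).mono fun k hk => hanti hk (hm k))⟩

theorem inner_le_of_forall_mem_closure_convexHull {E : Type*} [NormedAddCommGroup E]
    [InnerProductSpace ℝ E] {u : ℕ → E} {g e : E} {a : ℝ}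
    (hg : ∀ N, g ∈ closure (convexHull ℝ (u '' Ici N)))
    (h : ∀ᶠ n in atTop, inner ℝ e (u n) ≤ a) : inner ℝ e g ≤ a := by
  obtain ⟨N, hN⟩ := eventually_atTop.1 h
  have hcl : IsClosed {x : E | inner ℝ e x ≤ a} :=
    isClosed_le (continuous_const.inner continuous_id) continuous_const
  have hcv : Convex ℝ {x : E | inner ℝ e x ≤ a} :=
    convex_halfSpace_le (innerₗ E e).isLinear a
  refine closure_minimal (convexHull_min ?_ hcv) hcl (hg N)
  rintro _ ⟨n, hn, rfl⟩
  exact hN n hn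

theorem isClosed_setOf_ae_mem {α E : Type*} [MeasurableSpace α] {μ : Measure α}
    [NormedAddCommGroup E] {A : α → Set E} (hA : ∀ t, IsClosed (A t)) :
    IsClosed {c : Lp E 2 μ | ∀ᵐ t ∂μ, c t ∈ A t} := by
  refine IsSeqClosed.isClosed fun c g hc hg => ?_
  obtain ⟨φ, -, hφ⟩ := (tendstoInMeasure_of_tendsto_Lp hg).exists_seq_tendsto_ae
  filter_upwards [hφ, ae_all_iff.2 hc] with t ht hct
  exact (hA t).mem_of_tendsto ht (Eventually.of_forall fun n => hct _)

theorem convex_setOf_ae_mem {α E : Type*} [MeasurableSpace α] {μ : Measure α}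
    [NormedAddCommGroup E] [NormedSpace ℝ E] {A : α → Set E} (hA : ∀ t, Convex ℝ (A t)) :
    Convex ℝ {c : Lp E 2 μ | ∀ᵐ t ∂μ, c t ∈ A t} := by
  intro c hc d hd a b ha hb hab
  filter_upwards [hc, hd, Lp.coeFn_add (a • c) (b • d), Lp.coeFn_smul a c, Lp.coeFn_smul b d]
    with t h1 h2 h3 h4 h5
  rw [h3, Pi.add_apply, h4, h5]
  exact hA t h1 h2 ha hb hab

/-- A bounded sequence of functions has a generalized limit `g`: almost everywhere, `g` lies in the
closed convex hulls of all tails of the sequence, and whatever weak integrals converge along the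
sequence converge to those of `g`. -/
theorem exists_ae_mem_closure_convexHull {α K : Type*} [MeasurableSpace α] {μ : Measure α}
    [IsFiniteMeasure μ] [NormedAddCommGroup K] [InnerProductSpace ℝ K] [CompleteSpace K]
    {U : ℕ → α → K} (hU : ∀ n, AEStronglyMeasurable (U n) μ) {M : ℝ}
    (hM : ∀ n, ∀ᵐ t ∂μ, ‖U n t‖ ≤ M) :
    ∃ g : α → K, Integrable g μ ∧
      (∀ᵐ t ∂μ, ∀ N, g t ∈ closure (convexHull ℝ ((fun n => U n t) '' Ici N))) ∧
      ∀ (s : Set α) (e : K) (a : ℝ), MeasurableSet s →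
        Tendsto (fun n => ∫ t in s, inner ℝ e (U n t) ∂μ) atTop (𝓝 a) →
        ∫ t in s, inner ℝ e (g t) ∂μ = a := by
  have hmem : ∀ n, MemLp (U n) 2 μ := fun n => MemLp.of_bound (hU n) M (hM n)
  set u : ℕ → Lp K 2 μ := fun n => (hmem n).toLp (U n) with hu
  have hubd : ∃ B, ∀ n, ‖u n‖ ≤ B := by
    refine ⟨_, fun n => Lp.norm_le_of_ae_bound (C := |M|) (abs_nonneg _) ?_⟩
    filter_upwards [(hmem n).coeFn_toLp, hM n] with t h1 h2
    rw [h1]; exact h2.trans (le_abs_self _)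
  obtain ⟨B, hB⟩ := hubd
  obtain ⟨g, hg⟩ := exists_forall_mem_of_antitone_of_convex
    (K := fun N => closure (convexHull ℝ (u '' Ici N)))
    (fun i j hij => closure_mono (convexHull_mono (image_mono (Ici_subset_Ici.2 hij))))
    (fun n => ⟨u n, subset_closure (subset_convexHull ℝ _ ⟨n, self_mem_Ici, rfl⟩)⟩)
    (fun n => isClosed_closure) (fun n => (convex_convexHull ℝ _).closure) (M := B) (by
      intro x hx
      have : closure (convexHull ℝ (u '' Ici 0)) ⊆ Metric.closedBall 0 B := by
        refine closure_minimal (convexHull_min ?_ (convex_closedBall _ _))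
          Metric.isClosed_closedBall
        rintro _ ⟨n, -, rfl⟩
        simpa using hB n
      simpa using this hx)
  refine ⟨g, (Lp.memLp g).integrable one_le_two, ?_, ?_⟩
  · rw [ae_all_iff]
    intro N
    refine closure_minimal (convexHull_min ?_ (convex_setOf_ae_mem fun t => ?_))
      (isClosed_setOf_ae_mem fun t => ?_) (hg N)
    · rintro _ ⟨n, hn, rfl⟩
      filter_upwards [(hmem n).coeFn_toLp] with t ht
      rw [hu]
      simp only
      rw [ht]
      exact subset_closure (subset_convexHull ℝ _ ⟨n, hn, rfl⟩)
    · exact (convex_convexHull ℝ _).closure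
    · exact isClosed_closure
  · intro s e a hs ha
    have hμ : μ s ≠ ∞ := measure_ne_top _ _
    have key : ∀ n, inner ℝ (indicatorConstLp 2 hs hμ e) (u n) =
        ∫ t in s, inner ℝ e (U n t) ∂μ := by
      intro n
      rw [L2.inner_indicatorConstLp_eq_setIntegral_inner]
      refine integral_congr_ae (ae_restrict_of_ae ?_)
      filter_upwards [(hmem n).coeFn_toLp] with t ht
      rw [ht]
    rw [← L2.inner_indicatorConstLp_eq_setIntegral_inner ℝ g hs e hμ]
    simp_rw [← key] at ha
    refine le_antisymm (le_of_forall_gt_imp_ge_of_dense fun b hb => ?_)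
      (le_of_forall_lt_imp_le_of_dense fun b hb => ?_)
    · exact inner_le_of_forall_mem_closure_convexHull hg
        ((ha.eventually_lt_const hb).mono fun _ => le_of_lt)
    · have := inner_le_of_forall_mem_closure_convexHull
        (e := -(indicatorConstLp 2 hs hμ e)) (a := -b) hg
        ((ha.eventually_const_lt hb).mono fun n hn => by rw [inner_neg_left]; linarith)
      rw [inner_neg_left] at this
      linarith

/-! ### Normals at approximate projections -/

namespace Sweeping

variable {H : Type*} [NormedAddCommGroup H] [InnerProductSpace ℝ H]

theorem zero_mem_clarkeNormalCone {S : Set H} {x : H} (hx : x ∈ S) :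
    (0 : H) ∈ clarkeNormalCone S x :=
  ⟨hx, fun v _ => by simp⟩

theorem smul_mem_clarkeNormalCone {S : Set H} {x ξ : H} (hξ : ξ ∈ clarkeNormalCone S x) {c : ℝ}
    (hc : 0 ≤ c) : c • ξ ∈ clarkeNormalCone S x :=
  ⟨hξ.1, fun v hv => by
    rw [real_inner_smul_left]
    exact mul_nonpos_of_nonneg_of_nonpos hc (hξ.2 v hv)⟩

/-- Fréchet normals are Clarke normals. -/
theorem mem_clarkeNormalCone_of_forall_inner_le {S : Set H} {x ξ : H} (hx : x ∈ S)
    (hξ : ∀ ε : ℝ, 0 < ε → ∃ δ : ℝ, 0 < δ ∧ ∀ w ∈ S, ‖w - x‖ ≤ δ →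
      inner ℝ ξ (w - x) ≤ ε * ‖w - x‖) : ξ ∈ clarkeNormalCone S x := by
  refine ⟨hx, fun v hv => ?_⟩
  have hτ : Tendsto (fun n : ℕ => 1 / ((n : ℝ) + 1)) atTop (𝓝 0) :=
    tendsto_one_div_add_atTop_nhds_zero_nat
  obtain ⟨w, hw, hwS⟩ := hv (fun _ => x) (fun n => 1 / ((n : ℝ) + 1)) (fun _ => hx)
    tendsto_const_nhds (fun n => by positivity) hτ
  have key : ∀ ε : ℝ, 0 < ε → inner ℝ ξ v ≤ ε * ‖v‖ := by
    intro ε hε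
    obtain ⟨δ, hδ, h⟩ := hξ ε hε
    have hsm : Tendsto (fun n : ℕ => ‖(1 / ((n : ℝ) + 1)) • w n‖) atTop (𝓝 0) := by
      simpa using (hτ.smul hw).norm
    refine le_of_tendsto_of_tendsto (tendsto_const_nhds.inner hw) (hw.norm.const_mul ε) ?_
    filter_upwards [hsm.eventually_le_const hδ] with n hn
    have h1 := h _ (hwS n) (by simpa using hn)
    have hpos : (0 : ℝ) < 1 / ((n : ℝ) + 1) := by positivity
    rw [add_sub_cancel_left, real_inner_smul_right, norm_smul, Real.norm_of_nonneg hpos.le,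
      mul_left_comm] at h1
    exact le_of_mul_le_mul_left h1 hpos
  have hlim : Tendsto (fun ε : ℝ => ε * ‖v‖) (𝓝[>] 0) (𝓝 0) := by
    have : Tendsto (fun ε : ℝ => ε * ‖v‖) (𝓝 0) (𝓝 (0 * ‖v‖)) := tendsto_id.mul_const _
    rw [zero_mul] at this
    exact this.mono_left nhdsWithin_le_nhds
  exact ge_of_tendsto hlim (eventually_mem_nhdsWithin.mono fun ε hε => key ε hε)

/-- Near an approximate projection `z` of `y` there is a point `z'` at which `y - z` is almost
normal. The point `z'` minimises `‖y - u‖² + ‖u - z‖²` over `S`, which penalises the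
distance to `z` because
an exact projection of `y` may be far from `z`. -/
theorem exists_mem_clarkeNormalCone_of_mem_approxProj {S : Set H} (hS : BallCompact S)
    {ε : ℝ} {y z : H} (hz : z ∈ approxProj ε S y) :
    ∃ z', ‖z' - z‖ ^ 2 < ε ∧ (y - z') + (z - z') ∈ clarkeNormalCone S z' := by
  obtain ⟨hzS, hzd⟩ := hz
  set r := ‖z‖ + ‖y - z‖ + 1 with hr
  have hrpos : 0 < r := by positivity
  have hzK : z ∈ S ∩ Metric.closedBall 0 r :=
    ⟨hzS, by rw [mem_closedBall_zero_iff]; linarith [norm_nonneg (y - z)]⟩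
  obtain ⟨z', hz', hmin⟩ := (hS r hrpos).exists_isMinOn ⟨z, hzK⟩
    (f := fun u => ‖y - u‖ ^ 2 + ‖u - z‖ ^ 2) (by fun_prop)
  have hz0 : ‖y - z'‖ ^ 2 + ‖z' - z‖ ^ 2 ≤ ‖y - z‖ ^ 2 := by
    simpa using hmin hzK
  -- Points outside the ball are no competitors: they are farther from `z` than `y` is.
  have hall : ∀ w ∈ S, ‖y - z'‖ ^ 2 + ‖z' - z‖ ^ 2 ≤ ‖y - w‖ ^ 2 + ‖w - z‖ ^ 2 := by
    intro w hw
    by_cases hwr : ‖w‖ ≤ r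
    · exact hmin ⟨hw, by simpa using hwr⟩
    · have h1 : ‖w‖ ≤ ‖w - z‖ + ‖z‖ := by simpa using norm_add_le (w - z) z
      nlinarith [norm_nonneg (y - z), norm_nonneg (w - z), sq_nonneg ‖y - w‖]
  refine ⟨z', ?_, mem_clarkeNormalCone_of_forall_inner_le hz'.1 fun η hη => ⟨η, hη, ?_⟩⟩
  · have h1 : Metric.infDist y S ≤ ‖y - z'‖ := by
      rw [← dist_eq_norm]; exact Metric.infDist_le_dist_of_mem hz'.1
    have := Metric.infDist_nonneg (x := y) (s := S)
    nlinarith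
  · intro w hw hwη
    have h1 := hall w hw
    have e1 : y - w = (y - z') - (w - z') := by abel
    have e2 : w - z = (w - z') - (z - z') := by abel
    rw [e1, e2, norm_sub_sq_real (y - z'), norm_sub_sq_real (w - z'), norm_sub_rev z' z,
      real_inner_comm (z - z')] at h1
    rw [inner_add_left]
    nlinarith [norm_nonneg (w - z')]

theorem norm_sub_le_of_mem_approxProj {E : Type*} [NormedAddCommGroup E] {S : Set E} {ε : ℝ}
    {y z : E} (hε : 0 ≤ ε)
    (hz : z ∈ approxProj ε S y) : ‖y - z‖ ≤ Metric.infDist y S + √ε := by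
  have h0 := Metric.infDist_nonneg (x := y) (s := S)
  refine abs_le_of_sq_le_sq' ?_ (by positivity) |>.2
  nlinarith [hz.2, Real.sq_sqrt hε, mul_nonneg h0 (Real.sqrt_nonneg ε)]

end Sweeping

/-! ### Uniform partitions -/

namespace Sweeping

/-- The index `k` of the cell `]k μ, (k + 1) μ]` of the partition of mesh `μ` that contains `s > 0`;
truncated subtraction puts `s = 0` into the cell `0`. -/
noncomputable def cellIndex (μ s : ℝ) : ℕ := ⌈s / μ⌉₊ - 1

theorem measurable_cellIndex (μ : ℝ) : Measurable (cellIndex μ) :=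
  (measurable_from_top (f := fun k : ℕ => k - 1)).comp
    (Nat.measurable_ceil.comp (measurable_id.div_const μ))

theorem gridTime_succ (T : ℝ) (n k : ℕ) :
    gridTime T n (k + 1) = gridTime T n k + T / n := by
  simp only [gridTime]; push_cast; ring

theorem gridTime_mem_Icc {T : ℝ} (hT : 0 < T) {n k : ℕ} (hn : 1 ≤ n) (hk : k ≤ n) :
    gridTime T n k ∈ Icc 0 T := by
  have hn' : (0 : ℝ) < n := by exact_mod_cast hn
  have hk' : (k : ℝ) ≤ n := by exact_mod_cast hk
  refine ⟨by unfold gridTime; positivity, ?_⟩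
  calc (k : ℝ) * (T / n) ≤ n * (T / n) := by gcongr
    _ = T := by field_simp

theorem cellIndex_eq {T : ℝ} (hT : 0 < T) {n k : ℕ} (hn : 1 ≤ n) {s : ℝ}
    (hs : s ∈ Ioc (gridTime T n k) (gridTime T n (k + 1))) : cellIndex (T / n) s = k := by
  have hμ : 0 < T / n := div_pos hT (by exact_mod_cast hn)
  have : ⌈s / (T / n)⌉₊ = k + 1 := by
    rw [Nat.ceil_eq_iff (Nat.succ_ne_zero k)]
    refine ⟨?_, ?_⟩
    · rw [lt_div_iff₀ hμ]; simpa [gridTime] using hs.1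
    · rw [div_le_iff₀ hμ]; exact hs.2
  simp [cellIndex, this]

theorem cellIndex_lt {T : ℝ} (hT : 0 < T) {n : ℕ} (hn : 1 ≤ n) {s : ℝ} (hs : s ∈ Icc 0 T) :
    cellIndex (T / n) s < n := by
  have hn' : (0 : ℝ) < n := by exact_mod_cast hn
  have hμ : 0 < T / n := div_pos hT hn'
  have : ⌈s / (T / n)⌉₊ ≤ n := by
    rw [Nat.ceil_le, div_le_iff₀ hμ]
    have : (n : ℝ) * (T / n) = T := by field_simp
    linarith [hs.2]
  unfold cellIndex
  omega

theorem mem_Icc_cellIndex {T : ℝ} (hT : 0 < T) {n : ℕ} (hn : 1 ≤ n) {s : ℝ} (hs : s ∈ Icc 0 T) :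
    s ∈ Icc (gridTime T n (cellIndex (T / n) s)) (gridTime T n (cellIndex (T / n) s + 1)) := by
  have hn' : (0 : ℝ) < n := by exact_mod_cast hn
  have hμ : 0 < T / n := div_pos hT hn'
  rcases hs.1.eq_or_lt with h0 | h0
  · rw [← h0]
    simp [cellIndex, gridTime, hμ.le]
  · have hpos : 0 < ⌈s / (T / n)⌉₊ := Nat.ceil_pos.2 (div_pos h0 hμ)
    have hk : cellIndex (T / n) s + 1 = ⌈s / (T / n)⌉₊ := by unfold cellIndex; omega
    refine ⟨?_, ?_⟩
    · have : cellIndex (T / n) s < ⌈s / (T / n)⌉₊ := by omega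
      rw [Nat.lt_ceil, lt_div_iff₀ hμ] at this
      exact this.le
    · rw [hk]
      exact (div_le_iff₀ hμ).1 (Nat.le_ceil (s / (T / n)))

theorem aestronglyMeasurable_select {α E : Type*} [MeasurableSpace α] {μ : Measure α}
    [TopologicalSpace E] [TopologicalSpace.PseudoMetrizableSpace E] {κ : α → ℕ}
    (hκ : Measurable κ) {ψ : ℕ → α → E} (hψ : ∀ k, AEStronglyMeasurable (ψ k) μ) :
    AEStronglyMeasurable (fun a => ψ (κ a) a) μ := by
  have hU : (⋃ k, κ ⁻¹' {k}) = univ := by ext a; simp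
  rw [← Measure.restrict_univ (μ := μ), ← hU, aestronglyMeasurable_iUnion_iff]
  intro k
  have hm : MeasurableSet (κ ⁻¹' {k}) := hκ (measurableSet_singleton k)
  refine (hψ k).restrict.congr ((ae_restrict_iff' hm).2 (Eventually.of_forall fun a ha => ?_))
  have : κ a = k := ha
  simp only [this]

/-- A function obtained by selecting `ψ k` on the `k`-th cell is integrated cell by cell. -/
theorem integral_select {E : Type*} [NormedAddCommGroup E] [NormedSpace ℝ E] {T : ℝ} (hT : 0 < T)
    {n : ℕ} (hn : 1 ≤ n) {ψ : ℕ → ℝ → E} {W : ℝ → E}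
    (hW : ∀ s, W s = ψ (cellIndex (T / n) s) s)
    (hint : IntervalIntegrable W volume 0 T) {p : ℕ → E}
    (hp : ∀ k < n, p (k + 1) = p k + ∫ s in gridTime T n k..gridTime T n (k + 1), ψ k s) :
    ∀ k < n, ∀ t ∈ Icc (gridTime T n k) (gridTime T n (k + 1)),
      p 0 + ∫ s in 0..t, W s = p k + ∫ s in gridTime T n k..t, ψ k s := by
  have hμ : 0 < T / n := div_pos hT (by exact_mod_cast hn)
  have hsub : ∀ a ∈ Icc 0 T, ∀ b ∈ Icc 0 T, IntervalIntegrable W volume a b := fun a ha b hb =>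
    hint.mono_set (uIcc_subset_uIcc (by rwa [uIcc_of_le hT.le]) (by rwa [uIcc_of_le hT.le]))
  have h0 : (0 : ℝ) ∈ Icc 0 T := ⟨le_rfl, hT.le⟩
  have hcell : ∀ k < n, ∀ t ∈ Icc (gridTime T n k) (gridTime T n (k + 1)),
      ∫ s in gridTime T n k..t, W s = ∫ s in gridTime T n k..t, ψ k s := by
    intro k hk t ht
    rw [intervalIntegral.integral_of_le ht.1, intervalIntegral.integral_of_le ht.1]
    refine setIntegral_congr_fun measurableSet_Ioc fun s hs => ?_
    simp only [hW, cellIndex_eq hT hn ⟨hs.1, hs.2.trans ht.2⟩]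
  have hnode : ∀ k ≤ n, p 0 + ∫ s in 0..gridTime T n k, W s = p k := by
    intro k
    induction k with
    | zero => intro _; simp [gridTime]
    | succ k ih =>
      intro hk
      have hk' : k < n := hk
      rw [← intervalIntegral.integral_add_adjacent_intervals
        (hsub 0 h0 _ (gridTime_mem_Icc hT hn hk'.le))
        (hsub _ (gridTime_mem_Icc hT hn hk'.le) _ (gridTime_mem_Icc hT hn hk)),
        hcell k hk' _ ⟨by rw [gridTime_succ]; linarith, le_rfl⟩, ← add_assoc, ih hk'.le, hp k hk']
  intro k hk t ht
  have htT : t ∈ Icc 0 T := ⟨(gridTime_mem_Icc hT hn hk.le).1.trans ht.1,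
    ht.2.trans (gridTime_mem_Icc hT hn hk).2⟩
  rw [← intervalIntegral.integral_add_adjacent_intervals
        (hsub 0 h0 _ (gridTime_mem_Icc hT hn hk.le))
        (hsub _ (gridTime_mem_Icc hT hn hk.le) _ htT), hcell k hk t ht, ← add_assoc,
        hnode k hk.le]

/-- Discrete Grönwall inequality on a partition of mesh `μ`. -/
theorem discrete_gronwall {a : ℕ → ℝ} {A B μ : ℝ} (hA : 0 ≤ A) (hB : 0 ≤ B) (hμ : 0 ≤ μ)
    (ha0 : a 0 ≤ 0) {n : ℕ} (h : ∀ k < n, a (k + 1) ≤ a k + μ * (A + B * a k)) :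
    ∀ k ≤ n, a k ≤ k * μ * A * Real.exp (k * μ * B) := by
  intro k
  induction k with
  | zero => intro _; simpa using ha0
  | succ k ih =>
    intro hk
    have h1 := ih (by omega)
    have h2 := h k (by omega)
    have hq : 0 ≤ k * μ * B := by positivity
    have hE : Real.exp ((k + 1 : ℕ) * μ * B) = Real.exp (k * μ * B) * Real.exp (μ * B) := by
      rw [← Real.exp_add]; congr 1; push_cast; ring
    have h3 : 1 + μ * B ≤ Real.exp (μ * B) := by linarith [Real.add_one_le_exp (μ * B)]
    have h4 : 1 ≤ Real.exp ((k + 1 : ℕ) * μ * B) := Real.one_le_exp (by positivity)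
    calc a (k + 1) ≤ a k * (1 + μ * B) + μ * A := by linarith
      _ ≤ (k * μ * A * Real.exp (k * μ * B)) * Real.exp (μ * B)
          + μ * A * Real.exp ((k + 1 : ℕ) * μ * B) := by
        refine add_le_add (mul_le_mul h1 h3 (by positivity) (by positivity)) ?_
        exact le_mul_of_one_le_right (by positivity) h4
      _ = _ := by rw [hE]; push_cast; ring

variable {H : Type*} [NormedAddCommGroup H] [InnerProductSpace ℝ H]

/-- `y` is a Lipschitz curve with velocity `V + G`, where up to errors of size `δ` the vector
`G t` belongs to `F` and `-V t` to the normal cones of the moving set, in both cases at points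
close to `y t` and, for the moving set, at a time close to `t`. -/
structure IsApproxSolution (T : ℝ) (C : ℝ → Set H) (F : ℝ → H → Set H) (x₀ : H) (M δ : ℝ)
    (y V G : ℝ → H) : Prop where
  measurable_normal : AEStronglyMeasurable V (volume.restrict (Icc 0 T))
  measurable_pert : AEStronglyMeasurable G (volume.restrict (Icc 0 T))
  norm_normal_le : ∀ t ∈ Icc 0 T, ‖V t‖ ≤ M
  norm_pert_le : ∀ᵐ t ∂(volume.restrict (Icc 0 T)), ‖G t‖ ≤ M
  eq_integral : ∀ t ∈ Icc 0 T, y t = x₀ + ∫ s in 0..t, (V s + G s)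
  pert_mem : ∀ t ∈ Icc 0 T, ∃ p, ‖p - y t‖ ≤ δ ∧ G t ∈ F t p
  normal_mem : ∀ t ∈ Icc 0 T, ∃ τ ∈ Icc 0 T, |τ - t| ≤ δ ∧ ∃ z, ‖z - y t‖ ≤ δ ∧
    ∃ ξ ∈ clarkeNormalCone (C τ) z, ‖-V t - ξ‖ ≤ δ

end Sweeping

/-! ### A priori bounds and approximate solutions -/

namespace Sweeping

theorem infDist_le_of_hausdorffEDist_le {E : Type*} [PseudoMetricSpace E] {S S' : Set E} {L : ℝ}
    (hL : 0 ≤ L) (hH : Metric.hausdorffEDist S S' ≤ ENNReal.ofReal L) {p : E} (hp : p ∈ S) :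
    Metric.infDist p S' ≤ L :=
  ENNReal.toReal_le_of_le_ofReal hL ((Metric.infEDist_le_hausdorffEDist_of_mem hp).trans hH)

theorem norm_step_le {E : Type*} [NormedAddCommGroup E] {S S' : Set E} {L ε : ℝ}
    (hL : 0 ≤ L) (hε : 0 ≤ ε) (hH : Metric.hausdorffEDist S S' ≤ ENNReal.ofReal L) {p q I : E}
    (hp : p ∈ S) (hq : q ∈ approxProj ε S' (p + I)) : ‖q - p - I‖ ≤ L + ‖I‖ + √ε := by
  have h1 := norm_sub_le_of_mem_approxProj hε hq
  have h2 := infDist_le_of_hausdorffEDist_le hL hH hp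
  have h3 : Metric.infDist (p + I) S' ≤ Metric.infDist p S' + dist (p + I) p :=
    Metric.infDist_le_infDist_add_dist
  rw [dist_eq_norm, add_sub_cancel_left] at h3
  have h4 : ‖q - p - I‖ = ‖p + I - q‖ := by rw [← norm_neg]; congr 1; abel
  linarith

theorem norm_integral_le_of_ae_Icc {E : Type*} [NormedAddCommGroup E] [NormedSpace ℝ E] {T B : ℝ}
    {φ : ℝ → E} (hb : ∀ᵐ t ∂(volume.restrict (Icc 0 T)), ‖φ t‖ ≤ B) {a b : ℝ} (ha : 0 ≤ a)
    (hab : a ≤ b) (hbT : b ≤ T) : ‖∫ s in a..b, φ s‖ ≤ B * (b - a) := by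
  rw [← abs_of_nonneg (sub_nonneg.2 hab)]
  refine intervalIntegral.norm_integral_le_of_norm_le_const_ae ?_
  rw [ae_restrict_iff' measurableSet_Icc] at hb
  filter_upwards [hb] with t ht hts
  rw [uIoc_of_le hab] at hts
  exact ht ⟨ha.trans hts.1.le, hts.2.trans hbT⟩

theorem intervalIntegrable_of_ae_Icc {E : Type*} [NormedAddCommGroup E] {T B : ℝ} (hT : 0 ≤ T)
    {φ : ℝ → E} (hm : AEStronglyMeasurable φ (volume.restrict (Icc 0 T)))
    (hb : ∀ᵐ t ∂(volume.restrict (Icc 0 T)), ‖φ t‖ ≤ B) : IntervalIntegrable φ volume 0 T := by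
  rw [intervalIntegrable_iff_integrableOn_Icc_of_le hT]
  exact Integrable.of_bound hm B hb

variable {H : Type*} [NormedAddCommGroup H] [InnerProductSpace ℝ H]

/-- A priori bound on the nodes of the algorithm, uniform in the mesh. -/
theorem norm_node_sub_le {T : ℝ} (hT : 0 < T) {C : ℝ → Set H} {L_C : ℝ≥0}
    (hC_lip : ∀ t ∈ Icc 0 T, ∀ s ∈ Icc 0 T,
      Metric.hausdorffEDist (C t) (C s) ≤ ENNReal.ofReal (L_C * |t - s|))
    {h : H → ℝ} {L_h : ℝ≥0} (hh_lip : LipschitzWith L_h h) {f : ℝ → H → H} {b : ℝ}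
    (hf : ∀ x, ∀ᵐ t ∂(volume.restrict (Icc 0 T)), ‖f t x‖ ≤ h x + b) {x₀ : H} (hx₀ : x₀ ∈ C 0)
    (hb : 0 ≤ h x₀ + b)
    {n : ℕ} (hn : 1 ≤ n) {ε σ : ℝ} (hε : 0 ≤ ε) (hσ : √ε ≤ σ * (T / n)) {p : ℕ → H}
    (hp0 : p 0 = x₀)
    (hp : ∀ k < n, p (k + 1) ∈ approxProj ε (C (gridTime T n (k + 1)))
      (p k + ∫ s in gridTime T n k..gridTime T n (k + 1), f s (p k))) :
    ∀ k ≤ n, p k ∈ C (gridTime T n k) ∧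
      ‖p k - x₀‖ ≤ T * (2 * (h x₀ + b) + L_C + σ) *
        Real.exp (T * (2 * L_h)) := by
  have hn' : (0 : ℝ) < n := by exact_mod_cast hn
  have hμ : 0 < T / n := div_pos hT hn'
  have hσ0 : 0 ≤ σ := by
    by_contra hneg
    nlinarith [Real.sqrt_nonneg ε]
  have hmem : ∀ k ≤ n, p k ∈ C (gridTime T n k) := by
    intro k hk
    cases k with
    | zero => simpa [gridTime, hp0] using hx₀
    | succ k => exact (hp k hk).1
  have hstep : ∀ k < n, ‖p (k + 1) - x₀‖ ≤ ‖p k - x₀‖ +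
      T / n * ((2 * (h x₀ + b) + L_C + σ) + 2 * L_h * ‖p k - x₀‖) := by
    intro k hk
    have hg := gridTime_succ T n k
    set I := ∫ s in gridTime T n k..gridTime T n (k + 1), f s (p k) with hI
    have h1 := norm_step_le (L := L_C * (T / n)) (by positivity) hε (by
      convert hC_lip _ (gridTime_mem_Icc hT hn hk.le) _ (gridTime_mem_Icc hT hn hk) using 3
      rw [hg, sub_add_cancel_left, abs_neg, abs_of_pos hμ]) (hmem k hk.le) (hp k hk)
    have h2 : ‖I‖ ≤ (h (p k) + b) * (T / n) := by
      have := norm_integral_le_of_ae_Icc (hf (p k)) (gridTime_mem_Icc hT hn hk.le).1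
        (by rw [hg]; linarith) (gridTime_mem_Icc hT hn (Nat.succ_le_of_lt hk)).2
      rwa [hg, add_sub_cancel_left, ← hg] at this
    have h3 : h (p k) ≤ h x₀ + L_h * ‖p k - x₀‖ := by
      have := hh_lip.dist_le_mul (p k) x₀
      rw [Real.dist_eq, dist_eq_norm] at this
      linarith [le_abs_self (h (p k) - h x₀)]
    have h4 : ‖p (k + 1) - x₀‖ ≤ ‖p (k + 1) - p k - I‖ + ‖I‖ + ‖p k - x₀‖ := by
      calc ‖p (k + 1) - x₀‖ = ‖(p (k + 1) - p k - I) + I + (p k - x₀)‖ := by congr 1; abel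
        _ ≤ _ := norm_add₃_le
    nlinarith
  intro k hk
  refine ⟨hmem k hk, ?_⟩
  have hA : 0 ≤ 2 * (h x₀ + b) + L_C + σ := by positivity
  refine (discrete_gronwall (a := fun k => ‖p k - x₀‖) hA (by positivity : (0 : ℝ) ≤ 2 * L_h)
    hμ.le (by simp [hp0]) hstep k hk).trans ?_
  have hkT : k * (T / n) ≤ T := (gridTime_mem_Icc hT hn hk).2
  gcongr

/-- One run of the algorithm, with velocities bounded by `M`, is an approximate solution. -/
theorem isApproxSolution_of_nodes [CompleteSpace H] {T : ℝ} (hT : 0 < T) {C : ℝ → Set H}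
    (hC_compact : ∀ t ∈ Icc 0 T, BallCompact (C t)) {F : ℝ → H → Set H} {f : ℝ → H → H}
    (hf_mem : ∀ t ∈ Icc 0 T, ∀ x, f t x ∈ F t x)
    (hf_meas : ∀ x, AEStronglyMeasurable (fun t => f t x) (volume.restrict (Icc 0 T)))
    {x₀ : H} {n : ℕ} (hn : 1 ≤ n) {ε M δ : ℝ} {p : ℕ → H}
    (hp0 : p 0 = x₀)
    (hp : ∀ k < n, p (k + 1) ∈ approxProj ε (C (gridTime T n (k + 1)))
      (p k + ∫ s in gridTime T n k..gridTime T n (k + 1), f s (p k)))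
    (hfM : ∀ k < n, ∀ᵐ t ∂(volume.restrict (Icc 0 T)), ‖f t (p k)‖ ≤ M)
    (hvM : ∀ k < n, ‖p (k + 1) - p k - ∫ s in gridTime T n k..gridTime T n (k + 1), f s (p k)‖ ≤
      M * (T / n))
    (hδ : (4 * M + 1) * (T / n) + √ε + 2 * (√ε / (T / n)) ≤ δ)
    {y : ℝ → H} (hy0 : y 0 = x₀)
    (hy : ∀ k < n, ∀ t ∈ Ioc (gridTime T n k) (gridTime T n (k + 1)),
      y t = p k
        + ((t - gridTime T n k) / (T / n)) •
            (p (k + 1) - p k - ∫ s in gridTime T n k..gridTime T n (k + 1), f s (p k))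
        + ∫ s in gridTime T n k..t, f s (p k)) :
    ∃ V G, IsApproxSolution T C F x₀ M δ y V G := by
  have hn' : (0 : ℝ) < n := by exact_mod_cast hn
  have hμ : 0 < T / n := div_pos hT hn'
  set μ : ℝ := T / n with hμdef
  set v : ℕ → H := fun k => (1 / μ) •
    (p (k + 1) - p k - ∫ s in gridTime T n k..gridTime T n (k + 1), f s (p k)) with hv
  have hvn : ∀ k < n, ‖v k‖ ≤ M := by
    intro k hk
    rw [hv]
    simp only
    rw [norm_smul, Real.norm_of_nonneg (by positivity), one_div, inv_mul_le_iff₀ hμ]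
    linarith [hvM k hk]
  have hM : 0 ≤ M := (norm_nonneg _).trans (hvn 0 hn)
  have hε0 := Real.sqrt_nonneg ε
  have hε1 : 0 ≤ √ε / μ := by positivity
  set V : ℝ → H := fun s => v (cellIndex μ s) with hV
  set G : ℝ → H := fun s => f s (p (cellIndex μ s)) with hG
  have hVm : AEStronglyMeasurable V (volume.restrict (Icc 0 T)) :=
    aestronglyMeasurable_select (ψ := fun k _ => v k) (measurable_cellIndex μ)
      fun k => aestronglyMeasurable_const
  have hGm : AEStronglyMeasurable G (volume.restrict (Icc 0 T)) :=
    aestronglyMeasurable_select (ψ := fun k s => f s (p k)) (measurable_cellIndex μ)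
      fun k => hf_meas (p k)
  have hVb : ∀ t ∈ Icc 0 T, ‖V t‖ ≤ M := fun t ht => hvn _ (cellIndex_lt hT hn ht)
  have hGb : ∀ᵐ t ∂(volume.restrict (Icc 0 T)), ‖G t‖ ≤ M := by
    have : ∀ᵐ t ∂(volume.restrict (Icc 0 T)), ∀ k, k < n → ‖f t (p k)‖ ≤ M := by
      rw [ae_all_iff]
      intro k
      by_cases hk : k < n
      · filter_upwards [hfM k hk] with t ht _ using ht
      · exact Eventually.of_forall fun t h => absurd h hk
    filter_upwards [this, ae_restrict_mem measurableSet_Icc] with t ht hts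
    exact ht _ (cellIndex_lt hT hn hts)
  have hfi : ∀ k < n, ∀ t ∈ Icc 0 T, ∀ s ∈ Icc 0 T,
      IntervalIntegrable (fun s => f s (p k)) volume s t := fun k hk t ht s hs =>
    (intervalIntegrable_of_ae_Icc hT.le (hf_meas (p k)) (hfM k hk)).mono_set
      (uIcc_subset_uIcc (by rwa [uIcc_of_le hT.le]) (by rwa [uIcc_of_le hT.le]))
  have hcellint : ∀ k < n, ∀ t ∈ Icc (gridTime T n k) (gridTime T n (k + 1)),
      ∫ s in gridTime T n k..t, (v k + f s (p k)) =
        (t - gridTime T n k) • v k + ∫ s in gridTime T n k..t, f s (p k) := by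
    intro k hk t ht
    rw [intervalIntegral.integral_add intervalIntegrable_const (hfi k hk _
      ⟨(gridTime_mem_Icc hT hn hk.le).1.trans ht.1, ht.2.trans (gridTime_mem_Icc hT hn hk).2⟩ _
      (gridTime_mem_Icc hT hn hk.le)), intervalIntegral.integral_const]
  have hg : ∀ k, gridTime T n (k + 1) = gridTime T n k + μ := gridTime_succ T n
  have hint := integral_select hT hn (ψ := fun k s => v k + f s (p k)) (W := fun s => V s + G s)
    (p := p) (fun s => rfl)
    (intervalIntegrable_of_ae_Icc (B := M + M) hT.le (hVm.add hGm) (by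
      filter_upwards [hGb, ae_restrict_mem measurableSet_Icc] with t ht hts
      exact (norm_add_le _ _).trans (add_le_add (hVb t hts) ht))) (by
      intro k hk
      rw [hcellint k hk _ ⟨by rw [hg]; linarith, le_rfl⟩, hg, add_sub_cancel_left, ← hg, hv]
      simp only
      rw [smul_smul, mul_one_div_cancel hμ.ne', one_smul]
      abel)
  have hyint : ∀ t ∈ Icc 0 T, y t = x₀ + ∫ s in 0..t, (V s + G s) := by
    intro t ht
    rcases ht.1.eq_or_lt with h0 | h0
    · rw [← h0, hy0]; simp
    have hlt := cellIndex_lt hT hn ht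
    have hIcc := mem_Icc_cellIndex hT hn ht
    rw [← hp0, hint _ hlt t hIcc, hcellint _ hlt t hIcc]
    rcases hIcc.1.eq_or_lt with h1 | h1
    · -- `t > 0` lies in the interior or at the right end of its cell, never at the left end.
      exfalso
      have hc : 0 < ⌈t / μ⌉₊ := Nat.ceil_pos.2 (div_pos h0 hμ)
      have : cellIndex μ t < ⌈t / μ⌉₊ := by unfold cellIndex; omega
      rw [Nat.lt_ceil, lt_div_iff₀ hμ] at this
      exact this.ne h1
    · rw [hy _ hlt t ⟨h1, hIcc.2⟩, hv]
      simp only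
      rw [smul_smul, mul_one_div, add_assoc]
  have hdist : ∀ k < n, ∀ t ∈ Icc (gridTime T n k) (gridTime T n (k + 1)), t ∈ Icc 0 T →
      ‖y t - p k‖ ≤ 2 * M * μ := by
    intro k hk t ht htT
    rw [hyint t htT, ← hp0, hint k hk t ht, hcellint k hk t ht, add_sub_cancel_left]
    have h1 := norm_integral_le_of_ae_Icc (hfM k hk) (gridTime_mem_Icc hT hn hk.le).1 ht.1 htT.2
    have h2 : ‖(t - gridTime T n k) • v k‖ ≤ (t - gridTime T n k) * M := by
      rw [norm_smul, Real.norm_of_nonneg (sub_nonneg.2 ht.1)]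
      exact mul_le_mul_of_nonneg_left (hvn k hk) (sub_nonneg.2 ht.1)
    have h3 : t - gridTime T n k ≤ μ := by linarith [ht.2, hg k]
    have h4 := mul_le_mul_of_nonneg_left h3 hM
    linarith [norm_add_le ((t - gridTime T n k) • v k) (∫ s in gridTime T n k..t, f s (p k))]
  have hMμ : 0 ≤ M * μ := by positivity
  refine ⟨V, G, hVm, hGm, hVb, hGb, hyint, fun t ht => ?_, fun t ht => ?_⟩
  · refine ⟨p (cellIndex μ t), ?_, hf_mem t ht _⟩
    rw [norm_sub_rev]
    have := hdist _ (cellIndex_lt hT hn ht) t (mem_Icc_cellIndex hT hn ht) ht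
    linarith
  · have hk := cellIndex_lt hT hn ht
    have hIcc := mem_Icc_cellIndex hT hn ht
    set k := cellIndex μ t with hkdef
    have hτ := gridTime_mem_Icc hT hn (Nat.succ_le_of_lt hk)
    obtain ⟨z, hz, hN⟩ := exists_mem_clarkeNormalCone_of_mem_approxProj (hC_compact _ hτ) (hp k hk)
    have hzε : ‖z - p (k + 1)‖ ≤ √ε := Real.le_sqrt_of_sq_le hz.le
    refine ⟨_, hτ, ?_, z, ?_, _, smul_mem_clarkeNormalCone hN (one_div_pos.2 hμ).le, ?_⟩
    · rw [abs_of_nonneg (sub_nonneg.2 hIcc.2)]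
      linarith [hIcc.1, hg k]
    · have h1 := hdist k hk t hIcc ht
      have h2 : ‖y (gridTime T n (k + 1)) - p k‖ ≤ 2 * M * μ :=
        hdist k hk _ ⟨hIcc.1.trans hIcc.2, le_rfl⟩ hτ
      have h3 : y (gridTime T n (k + 1)) = p (k + 1) := by
        rw [hy k hk _ ⟨by rw [hg]; linarith, le_rfl⟩, hg, add_sub_cancel_left, div_self hμ.ne',
          one_smul]
        abel
      rw [h3] at h2
      have h4 : ‖z - y t‖ ≤ ‖z - p (k + 1)‖ + ‖p (k + 1) - p k‖ + ‖p k - y t‖ := by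
        calc ‖z - y t‖ = ‖(z - p (k + 1)) + (p (k + 1) - p k) + (p k - y t)‖ := by
              congr 1; abel
          _ ≤ _ := norm_add₃_le
      rw [norm_sub_rev (p k)] at h4
      linarith
    · have : -V t - (1 / μ) • (p k + (∫ s in gridTime T n k..gridTime T n (k + 1), f s (p k)) - z +
          (p (k + 1) - z)) = (2 / μ) • (z - p (k + 1)) := by
        have e : V t = (1 / μ) • (p (k + 1) - p k -
          ∫ s in gridTime T n k..gridTime T n (k + 1), f s (p k)) := rfl
        rw [e, ← smul_neg, ← smul_sub, show (2 / μ) = (1 / μ) * 2 by ring, mul_smul, two_smul]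
        congr 1
        abel
      rw [this, norm_smul, Real.norm_of_nonneg (by positivity)]
      have h5 : 2 / μ * ‖z - p (k + 1)‖ ≤ 2 / μ * √ε := by gcongr
      have h6 : 2 / μ * √ε = 2 * (√ε / μ) := by ring
      linarith

end Sweeping

/-! ### Compactness and closure of graphs -/

namespace Sweeping

/-- Arzelà–Ascoli for equi-Lipschitz curves each of whose values is asymptotically close to a
compact set. -/
theorem exists_subseq_tendstoUniformlyOn {E : Type*} [NormedAddCommGroup E] [CompleteSpace E]
    {T : ℝ} (hT : 0 ≤ T) {K : ℝ≥0} {y : ℕ → ℝ → E}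
    (hlip : ∀ n, LipschitzOnWith K (y n) (Icc 0 T))
    (hc : ∀ t ∈ Icc 0 T, ∃ Q : Set E, IsCompact Q ∧ ∃ z : ℕ → E, (∀ n, z n ∈ Q) ∧
      Tendsto (fun n => z n - y n t) atTop (𝓝 0)) :
    ∃ (φ : ℕ → ℕ) (x : ℝ → E), StrictMono φ ∧
      TendstoUniformlyOn (fun j => y (φ j)) x atTop (Icc 0 T) := by
  have hne : Nonempty (Icc 0 T) := ⟨⟨0, le_rfl, hT⟩⟩
  set d : ℕ → Icc 0 T := TopologicalSpace.denseSeq (Icc 0 T) with hd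
  choose! Q hQ z hzQ hz using hc
  -- Tychonoff at the points of a countable dense set.
  obtain ⟨L, -, φ, hφ, hL⟩ := (isCompact_univ_pi fun i => hQ (d i) (d i).2).tendsto_subseq
    (x := fun n i => z (d i) n) (fun n i _ => hzQ _ (d i).2 n)
  have hLd : ∀ i, Tendsto (fun j => y (φ j) (d i)) atTop (𝓝 (L i)) := by
    intro i
    have h1 := (tendsto_pi_nhds.1 hL i).sub ((hz _ (d i).2).comp hφ.tendsto_atTop)
    simpa [Function.comp_def] using h1
  have hdist : ∀ n, ∀ s ∈ Icc 0 T, ∀ t ∈ Icc 0 T, dist (y n s) (y n t) ≤ K * dist s t :=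
    fun n s hs t ht => (hlip n).dist_le_mul s hs t ht
  have hcau : ∀ t ∈ Icc 0 T, CauchySeq fun j => y (φ j) t := by
    intro t ht
    rw [Metric.cauchySeq_iff']
    intro ε hε
    have hK : (0 : ℝ) < K + 1 := by positivity
    obtain ⟨i, hi⟩ := (TopologicalSpace.denseRange_denseSeq (Icc 0 T)).exists_dist_lt ⟨t, ht⟩
      (show 0 < ε / 3 / (K + 1) by positivity)
    have hclose : ∀ n, dist (y n t) (y n (d i)) < ε / 3 := by
      intro n
      have h1 := hdist n t ht (d i) (d i).2
      have h2 : dist t (d i : ℝ) < ε / 3 / (K + 1) := hi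
      rw [lt_div_iff₀ hK] at h2
      nlinarith [dist_nonneg (x := t) (y := (d i : ℝ))]
    obtain ⟨N, hN⟩ := Metric.cauchySeq_iff'.1 (hLd i).cauchySeq (ε / 3) (by positivity)
    refine ⟨N, fun n hn => ?_⟩
    have h1 := hclose (φ n)
    have h2 := hclose (φ N)
    rw [dist_comm] at h2
    linarith [hN n hn, dist_triangle4 (y (φ n) t) (y (φ n) (d i)) (y (φ N) (d i)) (y (φ N) t)]
  have hx : ∀ t, ∃ a, t ∈ Icc 0 T → Tendsto (fun j => y (φ j) t) atTop (𝓝 a) := by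
    intro t
    by_cases ht : t ∈ Icc 0 T
    · obtain ⟨a, ha⟩ := cauchySeq_tendsto_of_complete (hcau t ht)
      exact ⟨a, fun _ => ha⟩
    · exact ⟨0, fun h => absurd h ht⟩
  choose x hx using hx
  refine ⟨φ, x, hφ, ?_⟩
  rw [tendstoUniformlyOn_iff_tendstoUniformly_comp_coe]
  have heq : Equicontinuous fun j (t : Icc 0 T) => y (φ j) t :=
    (LipschitzWith.uniformEquicontinuous _ K
      fun j => (lipschitzOnWith_iff_restrict.1 (hlip (φ j)))).equicontinuous
  exact UniformFun.tendsto_iff_tendstoUniformly.1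
    ((heq.tendsto_uniformFun_iff_pi _ _).2 (tendsto_pi_nhds.2 fun t => hx t t.2))

variable {H : Type*} [NormedAddCommGroup H] [InnerProductSpace ℝ H]

/-- Closure of the graph of a convex-valued map that is upper semicontinuous into the weak topology.
The hypothesis `hw` says that `w` lies in the closed convex hull of every tail of `G`; half-spaces
are weakly closed, so one that separates `w` from `Φ x` would also miss `Φ (p n)` for large `n`. -/
theorem mem_of_forall_inner_le [CompleteSpace H] {Φ : H → Set H}
    (hΦ : UpperSemicontinuousToWeak Φ) {x : H}
    (hcl : IsClosed (Φ x)) (hcv : Convex ℝ (Φ x)) {p G : ℕ → H} (hp : Tendsto p atTop (𝓝 x))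
    (hG : ∀ n, G n ∈ Φ (p n)) {w : H}
    (hw : ∀ (ζ : H) (a : ℝ), (∀ᶠ n in atTop, inner ℝ ζ (G n) ≤ a) → inner ℝ ζ w ≤ a) :
    w ∈ Φ x := by
  by_contra hwx
  obtain ⟨ℓ, u, hu, huw⟩ := geometric_hahn_banach_closed_point hcv hcl hwx
  set ζ := (InnerProductSpace.toDual ℝ H).symm ℓ with hζ
  have hℓ : ∀ a, inner ℝ ζ a = ℓ a := fun a => InnerProductSpace.toDual_symm_apply
  set W : Set H := {q | u ≤ inner ℝ ζ q} with hW
  have hWcl : IsClosed W := isClosed_le continuous_const (continuous_const.inner continuous_id)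
  have hWcv : Convex ℝ W := convex_halfSpace_ge (innerₗ H ζ).isLinear u
  have hWw : IsClosed (toWeakSpace ℝ H '' W) := by
    have := hWcv.toWeakSpace_closure ℝ
    rw [hWcl.closure_eq] at this
    rw [this]
    exact isClosed_closure
  have hxW : x ∉ {q | (Φ q ∩ W).Nonempty} := by
    rintro ⟨a, ha, haW⟩
    have h1 := hu a ha
    have h2 : u ≤ inner ℝ ζ a := haW
    rw [hℓ] at h2
    linarith
  have hev := hp.eventually ((hΦ W hWw).isOpen_compl.mem_nhds hxW)
  have := hw ζ u (hev.mono fun n hn => by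
    by_contra hlt
    exact hn ⟨G n, hG n, (not_le.1 hlt).le⟩)
  rw [hℓ] at this
  linarith

/-- Closure of the graph of the normal cones of an equi-uniformly subsmooth family. Subsmoothness,
tested against the zero normal at a nearby point of the set, turns `ξ n ∈ N` into inequalities that
are linear in `ξ n` with uniform constants. These survive passage to `v`, which lies in the closed
convex hull of every tail of `V` by `hv`, and they make `v` a Fréchet normal. -/
theorem mem_clarkeNormalCone_of_tendsto {T : ℝ} {C : ℝ → Set H}
    (hC_closed : ∀ t ∈ Icc 0 T, IsClosed (C t)) {L_C : ℝ≥0}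
    (hC_lip : ∀ t ∈ Icc 0 T, ∀ s ∈ Icc 0 T,
      Metric.hausdorffEDist (C t) (C s) ≤ ENNReal.ofReal (L_C * |t - s|))
    (hC_subsmooth : EquiUniformlySubsmooth (Icc 0 T) C)
    {t : ℝ} (ht : t ∈ Icc 0 T) {x v : H} {τ : ℕ → ℝ} {z ξ V : ℕ → H} {M : ℝ}
    (hτ : ∀ n, τ n ∈ Icc 0 T) (hτt : Tendsto τ atTop (𝓝 t)) (hz : Tendsto z atTop (𝓝 x))
    (hξ : ∀ n, ξ n ∈ clarkeNormalCone (C (τ n)) (z n)) (hV : ∀ n, ‖V n‖ ≤ M)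
    (hVξ : Tendsto (fun n => V n - ξ n) atTop (𝓝 0))
    (hv : ∀ (ζ : H) (a : ℝ), (∀ᶠ n in atTop, inner ℝ ζ (V n) ≤ a) → inner ℝ ζ v ≤ a) :
    v ∈ clarkeNormalCone (C t) x := by
  have hM : 0 ≤ M := (norm_nonneg _).trans (hV 0)
  have hzC : ∀ n, z n ∈ C (τ n) := fun n => (hξ n).1
  have hτ0 : Tendsto (fun n => L_C * |τ n - t|) atTop (𝓝 0) := by
    have : Tendsto (fun n => L_C * |τ n - t|) atTop (𝓝 (L_C * |t - t|)) :=
      ((hτt.sub_const t).abs).const_mul _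
    simpa using this
  have hinf : ∀ n, Metric.infDist (z n) (C t) ≤ L_C * |τ n - t| := fun n =>
    infDist_le_of_hausdorffEDist_le (by positivity) (hC_lip _ (hτ n) _ ht) (hzC n)
  have hinf' : ∀ w ∈ C t, ∀ n, Metric.infDist w (C (τ n)) ≤ L_C * |τ n - t| := fun w hw n => by
    have := infDist_le_of_hausdorffEDist_le (by positivity) (hC_lip _ ht _ (hτ n)) hw
    rwa [abs_sub_comm]
  have hne : (C t).Nonempty := Metric.nonempty_of_hausdorffEDist_ne_top ⟨z 0, hzC 0⟩
    (ne_top_of_le_ne_top ENNReal.ofReal_ne_top (hC_lip _ (hτ 0) _ ht))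
  have hxC : x ∈ C t := by
    rw [(hC_closed t ht).mem_iff_infDist_zero hne]
    have h1 : Tendsto (fun n => Metric.infDist (z n) (C t)) atTop (𝓝 (Metric.infDist x (C t))) :=
      ((Metric.continuous_infDist_pt _).tendsto x).comp hz
    exact tendsto_nhds_unique h1 (squeeze_zero (fun _ => Metric.infDist_nonneg) hinf hτ0)
  refine mem_clarkeNormalCone_of_forall_inner_le hxC fun ε hε => ?_
  set B := M + 1 with hB
  have hBpos : 0 < B := by positivity
  obtain ⟨δ, hδ, hsub⟩ := hC_subsmooth (ε / B) (by positivity)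
  -- Half the radius leaves room for moving `w` and `x` to `C (τ n)`.
  refine ⟨δ / 2, by positivity, fun w hw hwx => ?_⟩
  -- Approximate the competitor `w ∈ C t` by points of the sets `C (τ n)`.
  have hw' : ∀ n, ∃ w' ∈ C (τ n), dist w w' < L_C * |τ n - t| + 1 / ((n : ℝ) + 1) := fun n =>
    (Metric.infDist_lt_iff ⟨z n, hzC n⟩).1
      ((hinf' w hw n).trans_lt (lt_add_of_pos_right _ (by positivity)))
  choose w' hw'C hw'd using hw'
  have hw'lim : Tendsto w' atTop (𝓝 w) := by
    rw [tendsto_iff_dist_tendsto_zero]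
    refine squeeze_zero (fun _ => dist_nonneg) (fun n => ?_)
      (by simpa using hτ0.add tendsto_one_div_add_atTop_nhds_zero_nat)
    rw [dist_comm]
    simpa using (hw'd n).le
  have hdiff : Tendsto (fun n => w' n - z n) atTop (𝓝 (w - x)) := hw'lim.sub hz
  have hbound : Tendsto (fun n => ε * ‖w' n - z n‖ + ‖V n - ξ n‖ * ‖w - x‖ +
      B * ‖(w - x) - (w' n - z n)‖) atTop (𝓝 (ε * ‖w - x‖)) := by
    have h1 := ((hdiff.norm.const_mul ε).add (hVξ.norm.mul_const ‖w - x‖)).add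
      ((hdiff.const_sub (w - x)).norm.const_mul B)
    simpa using h1
  rw [real_inner_comm]
  refine le_of_forall_gt_imp_ge_of_dense fun a ha => hv _ _ ?_
  have hnear : ∀ᶠ n in atTop, ‖w' n - z n‖ < δ :=
    hdiff.norm.eventually_lt_const (by linarith)
  have hsmall : ∀ᶠ n in atTop, ‖V n - ξ n‖ < 1 := by
    have := hVξ.norm
    rw [norm_zero] at this
    exact this.eventually_lt_const one_pos
  filter_upwards [hbound.eventually_lt_const ha, hnear, hsmall] with n hn hn1 hn2
  have hξB : ‖ξ n‖ ≤ B := by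
    have : ‖ξ n‖ ≤ ‖V n‖ + ‖V n - ξ n‖ := by
      calc ‖ξ n‖ = ‖V n - (V n - ξ n)‖ := by congr 1; abel
        _ ≤ _ := norm_sub_le _ _
    linarith [hV n]
  have key := hsub (τ n) (hτ n) (z n) (hzC n) (w' n) (hw'C n) (by rw [norm_sub_rev]; exact hn1.le)
    _ (smul_mem_clarkeNormalCone (hξ n) (inv_pos.2 hBpos).le) 0
    (zero_mem_clarkeNormalCone (hw'C n)) (by
      rw [norm_smul, norm_inv, Real.norm_of_nonneg hBpos.le, inv_mul_le_iff₀ hBpos]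
      linarith) (by simp)
  rw [zero_sub, inner_neg_left, real_inner_smul_left, neg_mul, neg_le_neg_iff,
    inv_mul_le_iff₀ hBpos, ← mul_assoc, mul_div_cancel₀ _ hBpos.ne'] at key
  have hsplit : inner ℝ (w - x) (V n) = inner ℝ (ξ n) (w' n - z n) + inner ℝ (V n - ξ n) (w - x) +
      inner ℝ (ξ n) ((w - x) - (w' n - z n)) := by
    rw [real_inner_comm, inner_sub_left, inner_sub_right (ξ n) (w - x)]; ring
  have e1 := real_inner_le_norm (V n - ξ n) (w - x)
  have e2 := (real_inner_le_norm (ξ n) ((w - x) - (w' n - z n))).trans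
    (mul_le_mul_of_nonneg_right hξB (norm_nonneg _))
  linarith

end Sweeping

/-! ### Limits of approximate solutions -/

namespace Sweeping

variable {H : Type*} [NormedAddCommGroup H] [InnerProductSpace ℝ H]

namespace IsApproxSolution

variable {T M δ : ℝ} {C : ℝ → Set H} {F : ℝ → H → Set H} {x₀ : H} {y V G : ℝ → H}

theorem ae_norm_add_le (hy : IsApproxSolution T C F x₀ M δ y V G) :
    ∀ᵐ t ∂(volume.restrict (Icc 0 T)), ‖V t + G t‖ ≤ 2 * M := by
  filter_upwards [hy.norm_pert_le, ae_restrict_mem measurableSet_Icc] with t ht hts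
  linarith [norm_add_le (V t) (G t), hy.norm_normal_le t hts]

theorem lipschitzOnWith (hT : 0 ≤ T) (hy : IsApproxSolution T C F x₀ M δ y V G) :
    LipschitzOnWith (2 * M).toNNReal y (Icc 0 T) := by
  have hM : 0 ≤ 2 * M := by
    linarith [(norm_nonneg _).trans (hy.norm_normal_le 0 ⟨le_rfl, hT⟩)]
  have hint : IntervalIntegrable (fun s => V s + G s) volume 0 T :=
    intervalIntegrable_of_ae_Icc hT (hy.measurable_normal.add hy.measurable_pert) hy.ae_norm_add_le
  have hsub : ∀ a ∈ Icc 0 T, IntervalIntegrable (fun s => V s + G s) volume 0 a := fun a ha =>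
    hint.mono_set (uIcc_subset_uIcc_left (by rwa [uIcc_of_le hT]))
  have key : ∀ s ∈ Icc 0 T, ∀ t ∈ Icc 0 T, s ≤ t → dist (y t) (y s) ≤ 2 * M * (t - s) := by
    intro s hs t ht hst
    rw [hy.eq_integral s hs, hy.eq_integral t ht, dist_add_left, dist_eq_norm,
      intervalIntegral.integral_interval_sub_left (hsub t ht) (hsub s hs)]
    exact norm_integral_le_of_ae_Icc hy.ae_norm_add_le hs.1 hst ht.2
  refine LipschitzOnWith.of_dist_le_mul fun s hs t ht => ?_
  rw [Real.coe_toNNReal _ hM, Real.dist_eq]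
  rcases le_total s t with hst | hst
  · rw [dist_comm, abs_sub_comm, abs_of_nonneg (sub_nonneg.2 hst)]
    exact key s hs t ht hst
  · rw [abs_of_nonneg (sub_nonneg.2 hst)]
    exact key t ht s hs hst

theorem norm_sub_le (hT : 0 ≤ T) (hy : IsApproxSolution T C F x₀ M δ y V G) {t : ℝ}
    (ht : t ∈ Icc 0 T) : ‖y t - x₀‖ ≤ 2 * M * T := by
  rw [hy.eq_integral t ht, add_sub_cancel_left]
  have hM : 0 ≤ 2 * M := by
    linarith [(norm_nonneg _).trans (hy.norm_normal_le 0 ⟨le_rfl, hT⟩)]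
  have := norm_integral_le_of_ae_Icc hy.ae_norm_add_le le_rfl ht.1 ht.2
  nlinarith [ht.2]

end IsApproxSolution

/-- Approximate solutions with vanishing error have a uniformly convergent subsequence. -/
theorem exists_subseq_of_isApproxSolution [CompleteSpace H] {T : ℝ} (hT : 0 < T) {C : ℝ → Set H}
    {L_C : ℝ≥0}
    (hC_lip : ∀ t ∈ Icc 0 T, ∀ s ∈ Icc 0 T,
      Metric.hausdorffEDist (C t) (C s) ≤ ENNReal.ofReal (L_C * |t - s|))
    (hC_compact : ∀ t ∈ Icc 0 T, BallCompact (C t)) {F : ℝ → H → Set H} {x₀ : H} {M : ℝ}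
    {δ : ℕ → ℝ} (hδ : Tendsto δ atTop (𝓝 0)) {y V G : ℕ → ℝ → H}
    (hy : ∀ n, IsApproxSolution T C F x₀ M (δ n) (y n) (V n) (G n)) :
    ∃ (φ : ℕ → ℕ) (x : ℝ → H), StrictMono φ ∧
      TendstoUniformlyOn (fun j => y (φ j)) x atTop (Icc 0 T) := by
  refine exists_subseq_tendstoUniformlyOn hT.le (fun n => (hy n).lipschitzOnWith hT.le)
    fun t ht => ?_
  have hw : ∀ n, ∃ w ∈ C t, ‖w - y n t‖ < L_C * δ n + 1 / ((n : ℝ) + 1) + δ n := by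
    intro n
    obtain ⟨τ, hτ, hτt, z, hz, ξ, hξ, -⟩ := (hy n).normal_mem t ht
    have h1 := infDist_le_of_hausdorffEDist_le (by positivity) (hC_lip τ hτ t ht) hξ.1
    have h2 : Metric.infDist z (C t) < L_C * δ n + 1 / ((n : ℝ) + 1) := by
      have h3 : L_C * |τ - t| ≤ L_C * δ n := by gcongr
      have h4 : (0 : ℝ) < 1 / ((n : ℝ) + 1) := by positivity
      linarith
    have hne : (C t).Nonempty := Metric.nonempty_of_hausdorffEDist_ne_top ⟨z, hξ.1⟩
      (ne_top_of_le_ne_top ENNReal.ofReal_ne_top (hC_lip τ hτ t ht))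
    obtain ⟨w, hw, hwz⟩ := (Metric.infDist_lt_iff hne).1 h2
    refine ⟨w, hw, ?_⟩
    rw [dist_comm, dist_eq_norm] at hwz
    linarith [norm_sub_le_norm_sub_add_norm_sub w z (y n t)]
  choose w hwC hwd using hw
  have hlim : Tendsto (fun n => L_C * δ n + 1 / ((n : ℝ) + 1) + δ n) atTop (𝓝 0) := by
    simpa using ((hδ.const_mul (L_C : ℝ)).add tendsto_one_div_add_atTop_nhds_zero_nat).add hδ
  have hwy : Tendsto (fun n => w n - y n t) atTop (𝓝 0) :=
    squeeze_zero_norm (fun n => (hwd n).le) hlim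
  obtain ⟨B, hB⟩ := hlim.bddAbove_range
  have hr : ∀ n, ‖w n‖ ≤ |B| + 2 * M * T + ‖x₀‖ + 1 := by
    intro n
    have h1 : ‖w n‖ ≤ ‖w n - y n t‖ + ‖y n t - x₀‖ + ‖x₀‖ := by
      calc ‖w n‖ = ‖(w n - y n t) + (y n t - x₀) + x₀‖ := by congr 1; abel
        _ ≤ _ := norm_add₃_le
    linarith [hwd n, hB ⟨n, rfl⟩, le_abs_self B, (hy n).norm_sub_le hT.le ht]
  have hrpos : 0 < |B| + 2 * M * T + ‖x₀‖ + 1 := by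
    have := (norm_nonneg _).trans ((hy 0).norm_sub_le hT.le ht)
    positivity
  exact ⟨_, hC_compact t ht _ hrpos, w, fun n => ⟨hwC n, by simpa using hr n⟩, hwy⟩

/-- The velocities of approximate solutions have a limit in the sense of convex combinations of
their tails, and it is the velocity of the limit curve. The limits `v` and `w` of the two
components are obtained together, from one sequence with values in `H × H`. Since all that is used
of them is membership in closed convex sets, the conclusion speaks of closed half-spaces. -/
theorem exists_limit_velocity [CompleteSpace H] {T : ℝ} (hT : 0 < T) {C : ℝ → Set H}
    {F : ℝ → H → Set H} {x₀ : H} {M : ℝ} {δ : ℕ → ℝ} {y V G : ℕ → ℝ → H}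
    (hy : ∀ n, IsApproxSolution T C F x₀ M (δ n) (y n) (V n) (G n)) {x : ℝ → H}
    (hx : ∀ t ∈ Icc 0 T, Tendsto (fun n => y n t) atTop (𝓝 (x t))) :
    ∃ v w : ℝ → H, IntervalIntegrable (fun s => v s + w s) volume 0 T ∧
      (∀ t ∈ Icc 0 T, x t = x₀ + ∫ s in 0..t, (v s + w s)) ∧
      ∀ᵐ t ∂(volume.restrict (Icc 0 T)), ∀ (ζ : H) (a : ℝ),
        ((∀ᶠ n in atTop, inner ℝ ζ (V n t) ≤ a) → inner ℝ ζ (v t) ≤ a) ∧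
        ((∀ᶠ n in atTop, inner ℝ ζ (G n t) ≤ a) → inner ℝ ζ (w t) ≤ a) := by
  obtain ⟨g, hgi, hg, hgint⟩ := exists_ae_mem_closure_convexHull
    (μ := volume.restrict (Icc 0 T)) (M := 2 * M)
    (U := fun n t => WithLp.toLp 2 (V n t, G n t))
    (fun n => (WithLp.prodContinuousLinearEquiv 2 ℝ H H).symm.continuous.comp_aestronglyMeasurable
      ((hy n).measurable_normal.prodMk (hy n).measurable_pert))
    (fun n => by
      filter_upwards [(hy n).norm_pert_le, ae_restrict_mem measurableSet_Icc] with t ht hts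
      have h1 := (hy n).norm_normal_le t hts
      rw [WithLp.prod_norm_eq_of_L2]
      refine Real.sqrt_le_iff.2 ⟨by linarith [norm_nonneg (V n t)], ?_⟩
      change ‖V n t‖ ^ 2 + ‖G n t‖ ^ 2 ≤ _
      nlinarith [norm_nonneg (V n t), norm_nonneg (G n t)])
  set L : WithLp 2 (H × H) →L[ℝ] H × H :=
    (WithLp.prodContinuousLinearEquiv 2 ℝ H H).toContinuousLinearMap with hL
  have hvi : Integrable (fun t => (g t).fst + (g t).snd) (volume.restrict (Icc 0 T)) :=
    ((ContinuousLinearMap.fst ℝ H H + ContinuousLinearMap.snd ℝ H H).comp L).integrable_comp hgi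
  refine ⟨fun t => (g t).fst, fun t => (g t).snd, ?_, ?_, ?_⟩
  · rw [intervalIntegrable_iff_integrableOn_Icc_of_le hT.le]
    exact hvi
  · intro t ht
    have hres : (volume.restrict (Icc 0 T)).restrict (Ioc 0 t) = volume.restrict (Ioc 0 t) :=
      Measure.restrict_restrict_of_subset fun s hs => ⟨hs.1.le, hs.2.trans ht.2⟩
    have hvt : Integrable (fun t => (g t).fst + (g t).snd) (volume.restrict (Ioc 0 t)) := by
      rw [← hres]; exact hvi.restrict
    have hVt : ∀ n, Integrable (fun t => V n t + G n t) (volume.restrict (Ioc 0 t)) := fun n => by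
      rw [← hres]
      exact (Integrable.of_bound ((hy n).measurable_normal.add (hy n).measurable_pert) _
        (hy n).ae_norm_add_le).restrict
    rw [← sub_eq_iff_eq_add']
    refine ext_inner_left ℝ fun c => ?_
    rw [intervalIntegral.integral_of_le ht.1, ← integral_inner hvt c]
    have h1 := hgint (Ioc 0 t) (WithLp.toLp 2 (c, c)) (inner ℝ c (x t - x₀)) measurableSet_Ioc (by
      have h2 : Tendsto (fun n => inner ℝ c (y n t - x₀)) atTop (𝓝 (inner ℝ c (x t - x₀))) :=
        tendsto_const_nhds.inner ((hx t ht).sub_const x₀)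
      refine h2.congr fun n => ?_
      rw [hres, (hy n).eq_integral t ht, add_sub_cancel_left,
        intervalIntegral.integral_of_le ht.1, ← integral_inner (hVt n) c]
      simp only [WithLp.prod_inner_apply, inner_add_right])
    rw [hres] at h1
    rw [← h1]
    simp only [WithLp.prod_inner_apply, inner_add_right]
    rfl
  · filter_upwards [hg] with t ht ζ a
    refine ⟨fun h => ?_, fun h => ?_⟩
    · have := inner_le_of_forall_mem_closure_convexHull
        (e := WithLp.toLp 2 (ζ, (0 : H))) (a := a) ht
        (h.mono fun n hn => by simpa [WithLp.prod_inner_apply] using hn)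
      simpa [WithLp.prod_inner_apply] using this
    · have := inner_le_of_forall_mem_closure_convexHull
        (e := WithLp.toLp 2 ((0 : H), ζ)) (a := a) ht
        (h.mono fun n hn => by simpa [WithLp.prod_inner_apply] using hn)
      simpa [WithLp.prod_inner_apply] using this

/-- Limits of approximate solutions with vanishing error are solutions. Differentiability of `x`
a.e. comes from its representation as an integral, so Rademacher's theorem in `H` is not needed. -/
theorem isSweepingSolution_of_tendsto [CompleteSpace H] {T : ℝ} (hT : 0 < T) {C : ℝ → Set H}
    (hC_closed : ∀ t ∈ Icc 0 T, IsClosed (C t)) {L_C : ℝ≥0}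
    (hC_lip : ∀ t ∈ Icc 0 T, ∀ s ∈ Icc 0 T,
      Metric.hausdorffEDist (C t) (C s) ≤ ENNReal.ofReal (L_C * |t - s|))
    (hC_subsmooth : EquiUniformlySubsmooth (Icc 0 T) C) {F : ℝ → H → Set H}
    (hF_closed : ∀ t ∈ Icc 0 T, ∀ x, IsClosed (F t x))
    (hF_convex : ∀ t ∈ Icc 0 T, ∀ x, Convex ℝ (F t x))
    (hF_usc : ∀ t ∈ Icc 0 T, UpperSemicontinuousToWeak (F t)) {x₀ : H} {M : ℝ} {δ : ℕ → ℝ}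
    (hδ : Tendsto δ atTop (𝓝 0)) {y V G : ℕ → ℝ → H}
    (hy : ∀ n, IsApproxSolution T C F x₀ M (δ n) (y n) (V n) (G n)) {x : ℝ → H}
    (hx : ∀ t ∈ Icc 0 T, Tendsto (fun n => y n t) atTop (𝓝 (x t))) :
    IsSweepingSolution T C F x₀ x := by
  obtain ⟨v, w, hint, hxint, hvw⟩ := exists_limit_velocity hT hy hx
  have h0 : (0 : ℝ) ∈ Icc 0 T := ⟨le_rfl, hT.le⟩
  refine ⟨?_, by simpa using hxint 0 h0, ?_⟩
  · refine LipschitzOnWith.absolutelyContinuousOnInterval (K := (2 * M).toNNReal) ?_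
    rw [uIcc_of_le hT.le]
    refine LipschitzOnWith.of_dist_le_mul fun s hs t ht => ?_
    exact le_of_tendsto ((hx s hs).dist (hx t ht)) (Eventually.of_forall fun n =>
      ((hy n).lipschitzOnWith hT.le).dist_le_mul s hs t ht)
  · have hder := ae_restrict_of_ae (s := Icc 0 T) hint.ae_hasDerivAt_integral
    have hIoo : ∀ᵐ t ∂(volume.restrict (Icc 0 T)), t ∈ Ioo 0 T := by
      rw [← Measure.restrict_congr_set Ioo_ae_eq_Icc]
      exact ae_restrict_mem measurableSet_Ioo
    filter_upwards [hvw, hder, hIoo] with t hvwt hdt htI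
    have ht : t ∈ Icc 0 T := Ioo_subset_Icc_self htI
    have hd : HasDerivAt x (v t + w t) t := by
      have h1 := (hdt (by rwa [uIcc_of_le hT.le]) 0 (by rwa [uIcc_of_le hT.le])).const_add x₀
      refine h1.congr_of_eventuallyEq ?_
      filter_upwards [Ioo_mem_nhds htI.1 htI.2] with s hs
      exact hxint s (Ioo_subset_Icc_self hs)
    refine ⟨hd.differentiableAt, ?_⟩
    rw [hd.deriv]
    have hlim : ∀ {u : ℕ → H}, (∀ n, ‖u n - y n t‖ ≤ δ n) → Tendsto u atTop (𝓝 (x t)) := by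
      intro u hu
      simpa using (squeeze_zero_norm hu hδ).add (hx t ht)
    refine Set.add_mem_add ?_ ?_
    · rw [Set.mem_neg]
      choose τ hτ hτd z hz ξ hξ hξd using fun n => (hy n).normal_mem t ht
      have hτt : Tendsto τ atTop (𝓝 t) := by
        have : Tendsto (fun n => τ n - t) atTop (𝓝 0) := squeeze_zero_norm hτd hδ
        simpa using this.add_const t
      refine mem_clarkeNormalCone_of_tendsto hC_closed hC_lip hC_subsmooth ht (V := fun n => -V n t)
        (M := M) hτ hτt (hlim hz) hξ (fun n => by simpa using (hy n).norm_normal_le t ht)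
        (squeeze_zero_norm hξd hδ) fun ζ a h => ?_
      have := (hvwt (-ζ) a).1 (h.mono fun n hn => by simpa using hn)
      simpa using this
    · choose p hp hpF using fun n => (hy n).pert_mem t ht
      exact mem_of_forall_inner_le (hF_usc t ht) (hF_closed t ht _) (hF_convex t ht _) (hlim hp)
        hpF fun ζ a h => (hvwt ζ a).2 h

/-- The runs of the algorithm are approximate solutions, with a common bound on the velocities and
errors that vanish with the mesh. -/
theorem exists_isApproxSolution_of_isCatchingUpIterate [CompleteSpace H] {T : ℝ} (hT : 0 < T)
    {C : ℝ → Set H} {L_C : ℝ≥0}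
    (hC_lip : ∀ t ∈ Icc 0 T, ∀ s ∈ Icc 0 T,
      Metric.hausdorffEDist (C t) (C s) ≤ ENNReal.ofReal (L_C * |t - s|))
    (hC_compact : ∀ t ∈ Icc 0 T, BallCompact (C t)) {F : ℝ → H → Set H}
    {h : H → ℝ} (hh_nonneg : ∀ x, 0 ≤ h x) {L_h : ℝ≥0} (hh_lip : LipschitzWith L_h h)
    (hF_bound : ∀ x, ∀ᵐ t ∂(volume.restrict (Icc 0 T)), Metric.infDist 0 (F t x) ≤ h x)
    {γ : ℝ} (hγ : 0 < γ) {f : ℝ → H → H}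
    (hf_mem : ∀ t ∈ Icc 0 T, ∀ x, f t x ∈ approxProj γ (F t x) 0)
    (hf_meas : ∀ x, AEStronglyMeasurable (fun t => f t x) (volume.restrict (Icc 0 T)))
    {x₀ : H} (hx₀ : x₀ ∈ C 0) {ε : ℕ → ℝ} (hε_pos : ∀ n, 1 ≤ n → 0 < ε n)
    (hε_lim : Tendsto (fun n : ℕ => ε n / (T / n) ^ 2) atTop (𝓝 0)) {y : ℕ → ℝ → H}
    (hy : ∀ n, 1 ≤ n → IsCatchingUpIterate T C f x₀ (ε n) n (y n)) :
    ∃ (M : ℝ) (δ : ℕ → ℝ), Tendsto δ atTop (𝓝 0) ∧ ∀ n, 1 ≤ n →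
      ∃ V G, IsApproxSolution T C F x₀ M (δ n) (y n) V G := by
  have hf : ∀ x, ∀ᵐ t ∂(volume.restrict (Icc 0 T)), ‖f t x‖ ≤ h x + √γ := by
    intro x
    filter_upwards [hF_bound x, ae_restrict_mem measurableSet_Icc] with t ht hts
    have := norm_sub_le_of_mem_approxProj hγ.le (hf_mem t hts x)
    rw [zero_sub, norm_neg] at this
    linarith
  have hratio : ∀ n : ℕ, 1 ≤ n → √(ε n) / (T / n) = √(ε n / (T / n) ^ 2) := by
    intro n hn
    have hn' : (0 : ℝ) < n := by exact_mod_cast hn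
    rw [Real.sqrt_div (hε_pos n hn).le, Real.sqrt_sq (div_pos hT hn').le]
  have hratio_lim : Tendsto (fun n : ℕ => √(ε n) / (T / n)) atTop (𝓝 0) := by
    have h1 : Tendsto (fun n : ℕ => √(ε n / (T / n) ^ 2)) atTop (𝓝 0) := by
      simpa [Function.comp_def] using (Real.continuous_sqrt.tendsto 0).comp hε_lim
    exact h1.congr' ((eventually_ge_atTop 1).mono fun n hn => (hratio n hn).symm)
  obtain ⟨σ, hσ⟩ := hratio_lim.bddAbove_range
  have hσ' : ∀ n : ℕ, 1 ≤ n → √(ε n) ≤ σ * (T / n) := by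
    intro n hn
    have hn' : (0 : ℝ) < n := by exact_mod_cast hn
    exact (div_le_iff₀ (div_pos hT hn')).1 (hσ ⟨n, rfl⟩)
  have hσ0 : 0 ≤ σ := (by positivity : 0 ≤ √(ε 1) / (T / (1 : ℕ))).trans (hσ ⟨1, rfl⟩)
  set R : ℝ := T * (2 * (h x₀ + √γ) + L_C + σ) * Real.exp (T * (2 * L_h)) with hR
  set b : ℝ := h x₀ + L_h * R + √γ with hb
  have hmesh : Tendsto (fun n : ℕ => T / (n : ℝ)) atTop (𝓝 0) :=
    tendsto_const_div_atTop_nhds_zero_nat T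
  have hsqrt : Tendsto (fun n : ℕ => √(ε n)) atTop (𝓝 0) := by
    have h1 := hratio_lim.mul hmesh
    rw [zero_mul] at h1
    refine h1.congr' ((eventually_ge_atTop 1).mono fun n hn => ?_)
    have hn' : (0 : ℝ) < n := by exact_mod_cast hn
    exact div_mul_cancel₀ _ (div_pos hT hn').ne'
  refine ⟨L_C + b + σ, fun n => (4 * (L_C + b + σ) + 1) * (T / n) + √(ε n) +
    2 * (√(ε n) / (T / n)), ?_, fun n hn => ?_⟩
  · simpa using ((hmesh.const_mul (4 * (L_C + b + σ) + 1)).add hsqrt).add (hratio_lim.const_mul 2)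
  · have hn' : (0 : ℝ) < n := by exact_mod_cast hn
    have hμ : 0 < T / n := div_pos hT hn'
    obtain ⟨p, hp0, hp, hy0, hyp⟩ := hy n hn
    have hnode := norm_node_sub_le hT hC_lip hh_lip hf hx₀
      (add_nonneg (hh_nonneg x₀) (Real.sqrt_nonneg γ)) hn (hε_pos n hn).le (hσ' n hn) hp0 hp
    have hfb : ∀ k ≤ n, ∀ᵐ t ∂(volume.restrict (Icc 0 T)), ‖f t (p k)‖ ≤ b := by
      intro k hk
      filter_upwards [hf (p k)] with t ht
      have h1 := hh_lip.dist_le_mul (p k) x₀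
      rw [Real.dist_eq, dist_eq_norm] at h1
      have h2 : L_h * ‖p k - x₀‖ ≤ L_h * R := by gcongr; exact (hnode k hk).2
      linarith [le_abs_self (h (p k) - h x₀)]
    refine isApproxSolution_of_nodes hT hC_compact (fun t ht x => (hf_mem t ht x).1) hf_meas hn hp0
      hp (fun k hk => ?_) (fun k hk => ?_) le_rfl hy0 hyp
    · filter_upwards [hfb k hk.le] with t ht
      linarith [L_C.coe_nonneg]
    · have hg := gridTime_succ T n k
      have h1 := norm_step_le (L := L_C * (T / n)) (by positivity) (hε_pos n hn).le (by
        convert hC_lip _ (gridTime_mem_Icc hT hn hk.le) _ (gridTime_mem_Icc hT hn hk) using 3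
        rw [hg, sub_add_cancel_left, abs_neg, abs_of_pos hμ]) (hnode k hk.le).1 (hp k hk)
      have h2 := norm_integral_le_of_ae_Icc (hfb k hk.le) (gridTime_mem_Icc hT hn hk.le).1
        (by rw [hg]; linarith) (gridTime_mem_Icc hT hn (Nat.succ_le_of_lt hk)).2
      have h3 : b * (gridTime T n (k + 1) - gridTime T n k) = b * (T / n) := by
        rw [hg, add_sub_cancel_left]
      linarith [hσ' n hn]

end Sweeping

/-! ### Convergence of the algorithm -/

theorem theorem5p1 {H : Type*} [NormedAddCommGroup H] [InnerProductSpace ℝ H] [CompleteSpace H]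
    (T : ℝ) (hT : 0 < T)
    -- the moving set
    (C : ℝ → Set H)
    (hC_nonempty : ∀ t ∈ Icc 0 T, (C t).Nonempty)
    (hC_closed : ∀ t ∈ Icc 0 T, IsClosed (C t))
    (L_C : ℝ≥0)
    (hC_lip : ∀ t ∈ Icc 0 T, ∀ s ∈ Icc 0 T,
      Metric.hausdorffEDist (C t) (C s) ≤ ENNReal.ofReal (L_C * |t - s|))
    (hC_subsmooth : Sweeping.EquiUniformlySubsmooth (Icc 0 T) C)
    (hC_compact : ∀ t ∈ Icc 0 T, Sweeping.BallCompact (C t))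
    -- the set-valued perturbation
    (F : ℝ → H → Set H)
    (hF_nonempty : ∀ t ∈ Icc 0 T, ∀ x, (F t x).Nonempty)
    (hF_closed : ∀ t ∈ Icc 0 T, ∀ x, IsClosed (F t x))
    (hF_convex : ∀ t ∈ Icc 0 T, ∀ x, Convex ℝ (F t x))
    (hF_usc : ∀ t ∈ Icc 0 T, Sweeping.UpperSemicontinuousToWeak (F t))
    (h : H → ℝ) (hh_nonneg : ∀ x, 0 ≤ h x) (L_h : ℝ≥0) (hh_lip : LipschitzWith L_h h)
    (hF_bound : ∀ x, ∀ᵐ t ∂(volume.restrict (Icc 0 T)), Metric.infDist 0 (F t x) ≤ h x)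
    -- the measurable selection used by the algorithm
    (γ : ℝ) (hγ : 0 < γ) (f : ℝ → H → H)
    (hf_mem : ∀ t ∈ Icc 0 T, ∀ x, f t x ∈ Sweeping.approxProj γ (F t x) 0)
    (hf_meas : ∀ x, AEStronglyMeasurable (fun t => f t x) (volume.restrict (Icc 0 T)))
    -- the algorithm
    (x₀ : H) (hx₀ : x₀ ∈ C 0)
    (ε : ℕ → ℝ) (hε_pos : ∀ n, 1 ≤ n → 0 < ε n)
    (hε_lim : Tendsto (fun n : ℕ => ε n / (T / n) ^ 2) atTop (𝓝 0))
    (y : ℕ → ℝ → H)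
    (hy : ∀ n, 1 ≤ n → Sweeping.IsCatchingUpIterate T C f x₀ (ε n) n (y n)) :
    ∃ (φ : ℕ → ℕ) (x : ℝ → H), StrictMono φ ∧ (∀ j, 1 ≤ φ j) ∧
      TendstoUniformlyOn (fun j => y (φ j)) x atTop (Icc 0 T) ∧
      Sweeping.IsSweepingSolution T C F x₀ x := by
  obtain ⟨M, δ, hδ, happ⟩ := Sweeping.exists_isApproxSolution_of_isCatchingUpIterate hT hC_lip
    hC_compact hh_nonneg hh_lip hF_bound hγ hf_mem hf_meas hx₀ hε_pos hε_lim hy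
  choose V G hVG using fun n : ℕ => happ (n + 1) (Nat.le_add_left 1 n)
  have hδ' : Tendsto (fun n => δ (n + 1)) atTop (𝓝 0) := (tendsto_add_atTop_iff_nat 1).2 hδ
  obtain ⟨φ, x, hφ, hx⟩ :=
    Sweeping.exists_subseq_of_isApproxSolution hT hC_lip hC_compact hδ' hVG
  refine ⟨fun j => φ j + 1, x, fun i j hij => Nat.succ_lt_succ (hφ hij),
    fun j => Nat.le_add_left 1 _, hx, ?_⟩
  exact Sweeping.isSweepingSolution_of_tendsto hT hC_closed hC_lip hC_subsmooth hF_closed hF_convex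
    hF_usc (hδ'.comp hφ.tendsto_atTop) (fun j => hVG (φ j)) fun t ht => hx.tendsto_at ht
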